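/- Let $(G,c)$ be a resistance network: $V$ is a set, $c:V\times V\to[0,\infty)$ is symmetric with $c_{xx}=0$ and $\sum_{y}c_{xy}<\infty$ for every $x$, and the graph $G$ on $V$, in which $x$ and $y$ are adjacent iff $c_{xy}>0$, is connected. For finite $H\subseteq V$ inducing a connected subgraph of $G$, the wired network $H^W$ has vertex set $H\cup\{\infty\}$ and conductances $c_{xy}$ for $x,y\in H$ and $c_{x\infty}=\sum_{y\notin H}c_{xy}$. For $x,y\in H$, the effective resistance $R_{H^W}(x,y)$ is the voltage drop $v(x)-v(y)$, where $v$ is a function on $H\cup\{\infty\}$ with $\Delta v=\delta_x-\delta_y$ and $(\Delta v)(z)=\sum_w c_{zw}(v(z)-v(w))$ is the Laplacian of $H^W$. The wired resistance is $R^W(x,y)=\lim_{k\to\infty}R_{G_k^W}(x,y)$, where $(G_k)$ is any exhaustion of $G$, i.e. an increasing sequence of finite vertex sets with union $V$, each inducing a connected subgraph. Let $\mathcal E(u,v)=\frac12\sum_{x,y\in V}c_{xy}(u(x)-u(y))(v(x)-v(y))$, and let $\mathcal H_{\mathcal E}$ be the Hilbert space of real functions $u$ on $V$ with $\mathcal E(u,u)<\infty$,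 modulo constants, with inner product $\mathcal E$. Let $\mathcal{F}in\subseteq\mathcal H_{\mathcal E}$ be the closure of the set of classes of functions of finite energy that are constant off a finite set. For an origin $o\in V$, let $v_x\in\mathcal H_{\mathcal E}$ be the element with $\langle v_x,u\rangle_{\mathcal E}=u(x)-u(o)$ for all $u\in\mathcal H_{\mathcal E}$, and let $f_x=P_{\mathcal{F}in}v_x$ be its orthogonal projection to $\mathcal{F}in$. Then exhaustions exist, the limit $R^W(x,y)$ exists along every exhaustion and does not depend on the exhaustion, and $R^W$ is a metric on $V$. The metric space $(G,R^W)$ embeds isometrically, in the square-root sense, into a Hilbert space: there are a real Hilbert space $\mathcal H$ and an injective map $w:V\to\mathcal H$ with $$R^W(x,y)^{1/2}=\|w_x-w_y\|_{\mathcal H}\qquad\text{for all }x,y\in V.$$ In fact, for every choice of the origin $o$, the map $x\mapsto f_x$ from $V$ to the Hilbert space $\mathcal{F}in$ is such an embedding: it is injective and $R^W(x,y)^{1/2}=\|f_x-f_y\|_{\mathcal E}$ for all $x,y\in V$. -/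

import Mathlib

open Filter Topology

universe u

/-- The graph on `V` in which `x` and `y` are adjacent iff the conductance `c x y` is positive. -/
def conductanceGraph {V : Type*} (c : V → V → ℝ) (hsymm : ∀ x y, c x y = c y x)
    (hself : ∀ x, c x x = 0) : SimpleGraph V where
  Adj x y := 0 < c x y
  symm := ⟨fun x y h => by rwa [hsymm y x]⟩
  loopless := ⟨fun x h => by simp [hself x] at h⟩

/-- A resistance network: a connected graph given by a symmetric conductance function with
values in `[0, ∞)`, without loops, and with finite total conductance at every vertex (vertices may
have infinitely many neighbours). -/
structure ResistanceNetwork (V : Type*) where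
  c : V → V → ℝ
  symm : ∀ x y, c x y = c y x
  nonneg : ∀ x y, 0 ≤ c x y
  self : ∀ x, c x x = 0
  summable : ∀ x, Summable (c x)
  connected : (conductanceGraph c symm self).Connected

/-- Effective resistance in a network with finite vertex set `W` and conductances `c`: the voltage
drop `v x - v y`, where `v` is a solution of the equation `Δ v = δ_x - δ_y`, i.e. of Kirchhoff's
law for a unit current that is inserted at `x` and withdrawn at `y`. -/
noncomputable def effectiveResistance {W : Type*} [Fintype W] (c : W → W → ℝ) (x y : W) : ℝ :=
  Classical.epsilon fun r : ℝ => ∃ v : W → ℝ,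
    (∀ z, ∑ w, c z w * (v z - v w) =
      Set.indicator {x} (fun _ => (1 : ℝ)) z - Set.indicator {y} (fun _ => (1 : ℝ)) z) ∧ v x - v y = r

namespace ResistanceNetwork

variable {V : Type*} (N : ResistanceNetwork V)

/-- The underlying graph. -/
abbrev graph : SimpleGraph V := conductanceGraph N.c N.symm N.self

/-! ### Wired resistance -/

/-- An exhaustion by finite connected full subnetworks, given by their vertex sets. -/
structure IsExhaustion (G : ℕ → Finset V) : Prop where
  monotone : Monotone G
  connected : ∀ k, (N.graph.induce (G k : Set V)).Connected
  exhausts : ∀ x, ∃ k, x ∈ G k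

/-- The conductances of the wired subnetwork on `H ∪ {∞}`: all vertices outside `H` are identified
to the single vertex `∞ = none`. -/
noncomputable def wiredConductance (H : Finset V) : Option H → Option H → ℝ
  | some a, some b => N.c a b
  | some a, none => ∑' y : {y : V // y ∉ H}, N.c a y
  | none, some b => ∑' y : {y : V // y ∉ H}, N.c b y
  | none, none => 0

open Classical in
/-- The effective resistance between `x` and `y` in the wired subnetwork on `H ∪ {∞}`.  It is
meaningful for `x, y ∈ H`, which holds for all but finitely many members of an exhaustion. -/
noncomputable def wiredSubnetworkResistance (H : Finset V) (x y : V) : ℝ :=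
  if h : x ∈ H ∧ y ∈ H then
    effectiveResistance (N.wiredConductance H) (some ⟨x, h.1⟩) (some ⟨y, h.2⟩)
  else 0

/-- The wired resistance: the limit of the resistances in the wired subnetworks of any
exhaustion. -/
noncomputable def wiredResistance (x y : V) : ℝ :=
  Classical.epsilon fun r : ℝ => ∀ G : ℕ → Finset V, N.IsExhaustion G →
    Tendsto (fun k => N.wiredSubnetworkResistance (G k) x y) atTop (𝓝 r)

/-! ### The energy space -/

/-- The energy form `(1/2) ∑_{x, y} c_{xy} (u x - u y) (v x - v y)`. -/
noncomputable def energy (u v : V → ℝ) : ℝ :=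
  (1 / 2) * ∑' p : V × V, N.c p.1 p.2 * ((u p.1 - u p.2) * (v p.1 - v p.2))

lemma summable_mul {u v : V → ℝ}
    (hu : Summable fun p : V × V => N.c p.1 p.2 * (u p.1 - u p.2) ^ 2)
    (hv : Summable fun p : V × V => N.c p.1 p.2 * (v p.1 - v p.2) ^ 2) :
    Summable fun p : V × V => N.c p.1 p.2 * ((u p.1 - u p.2) * (v p.1 - v p.2)) := by
  refine Summable.of_norm_bounded (hu.add hv) fun p => ?_
  have h := N.nonneg p.1 p.2
  rw [Real.norm_eq_abs, abs_mul, abs_of_nonneg h, ← mul_add]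
  refine mul_le_mul_of_nonneg_left ?_ h
  rw [abs_le]
  constructor <;>
    nlinarith [sq_nonneg ((u p.1 - u p.2) + (v p.1 - v p.2)),
      sq_nonneg ((u p.1 - u p.2) - (v p.1 - v p.2)), sq_nonneg (u p.1 - u p.2),
      sq_nonneg (v p.1 - v p.2)]

/-- The domain of the energy: the functions of finite energy. -/
def energyDomain : Submodule ℝ (V → ℝ) where
  carrier := {u | Summable fun p : V × V => N.c p.1 p.2 * (u p.1 - u p.2) ^ 2}
  zero_mem' := by simp
  add_mem' := by
    intro u v hu hv
    refine ((hu.add hv).add ((N.summable_mul hu hv).mul_left 2)).congr fun p => ?_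
    simp only [Pi.add_apply]
    ring
  smul_mem' := by
    intro a u hu
    refine (Summable.mul_left (a ^ 2) hu).congr fun p => ?_
    simp only [Pi.smul_apply, smul_eq_mul]
    ring

/-- The constant functions, as a subspace of the domain of the energy. -/
def constants : Submodule ℝ N.energyDomain :=
  (Submodule.span ℝ {(1 : V → ℝ)}).comap N.energyDomain.subtype

/-- The energy space: functions of finite energy modulo constants. -/
def EnergySpace : Type _ := N.energyDomain ⧸ N.constants

noncomputable instance : AddCommGroup N.EnergySpace :=
  inferInstanceAs (AddCommGroup (N.energyDomain ⧸ N.constants))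

noncomputable instance : Module ℝ N.EnergySpace :=
  inferInstanceAs (Module ℝ (N.energyDomain ⧸ N.constants))

/-- The class of a function of finite energy. -/
noncomputable def toEnergySpace : N.energyDomain →ₗ[ℝ] N.EnergySpace := N.constants.mkQ

lemma toEnergySpace_surjective : Function.Surjective N.toEnergySpace :=
  N.constants.mkQ_surjective

lemma const_of_mem {u : N.energyDomain} (hu : u ∈ N.constants) (x y : V) :
    (u : V → ℝ) x = (u : V → ℝ) y := by
  obtain ⟨a, ha⟩ := Submodule.mem_span_singleton.1 (Submodule.mem_comap.1 hu)
  have hx := congrFun ha x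
  have hy := congrFun ha y
  simp at hx hy
  rw [← hx, ← hy]

/-- The functional `u ↦ u x - u y` on the energy space. -/
noncomputable def diffₗ (x y : V) : N.EnergySpace →ₗ[ℝ] ℝ :=
  N.constants.liftQ
    ((LinearMap.proj (R := ℝ) (φ := fun _ : V => ℝ) x - LinearMap.proj y) ∘ₗ N.energyDomain.subtype)
    (by
      intro u hu
      simp [N.const_of_mem hu x y])

lemma diffₗ_mk (x y : V) (u : N.energyDomain) :
    N.diffₗ x y (N.toEnergySpace u) = (u : V → ℝ) x - (u : V → ℝ) y := rfl

/-- The inner product of the energy space is the energy form, computed on representatives. -/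
noncomputable def energyInner (u v : N.EnergySpace) : ℝ :=
  Quotient.liftOn₂' u v (fun u v : N.energyDomain => N.energy u v) (by
    intro u v u' v' hu hv
    have hu' := N.const_of_mem ((Submodule.quotientRel_def _).1 hu)
    have hv' := N.const_of_mem ((Submodule.quotientRel_def _).1 hv)
    simp only [energy]
    congr 2
    funext p
    have h1 := hu' p.1 p.2
    have h2 := hv' p.1 p.2
    simp only [Submodule.coe_sub, Pi.sub_apply] at h1 h2
    have e1 : (u : V → ℝ) p.1 - (u : V → ℝ) p.2 = (u' : V → ℝ) p.1 - (u' : V → ℝ) p.2 := by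
      linarith
    have e2 : (v : V → ℝ) p.1 - (v : V → ℝ) p.2 = (v' : V → ℝ) p.1 - (v' : V → ℝ) p.2 := by
      linarith
    rw [e1, e2])

lemma energyInner_mk (u v : N.energyDomain) :
    N.energyInner (N.toEnergySpace u) (N.toEnergySpace v) = N.energy u v := rfl

lemma sum_le_energy (u : N.energyDomain) (s : Finset (V × V)) :
    ∑ p ∈ s, N.c p.1 p.2 * ((u : V → ℝ) p.1 - (u : V → ℝ) p.2) ^ 2 ≤ 2 * N.energy u u := by
  have h : ∑ p ∈ s, N.c p.1 p.2 * ((u : V → ℝ) p.1 - (u : V → ℝ) p.2) ^ 2 ≤ _ :=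
    u.2.sum_le_tsum s fun p _ => mul_nonneg (N.nonneg p.1 p.2) (sq_nonneg _)
  refine h.trans (le_of_eq ?_)
  simp [energy, pow_two]

lemma edge_le_energy (u : N.energyDomain) (x y : V) :
    N.c x y * ((u : V → ℝ) x - (u : V → ℝ) y) ^ 2 ≤ 2 * N.energy u u := by
  simpa using N.sum_le_energy u {(x, y)}

lemma eq_of_energy_eq_zero (u : N.energyDomain) (hu : N.energy u u = 0) (x y : V) :
    (u : V → ℝ) x = (u : V → ℝ) y := by
  obtain ⟨w⟩ := N.connected.preconnected x y
  induction w with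
  | nil => rfl
  | @cons a b d h _ ih =>
    have h1 := N.edge_le_energy u a b
    have h2 : 0 < N.c a b := h
    rw [← ih]
    rw [hu, mul_zero] at h1
    have h3 : ((u : V → ℝ) a - (u : V → ℝ) b) ^ 2 ≤ 0 := by
      by_contra! h4
      nlinarith [mul_pos h2 h4]
    nlinarith [pow_eq_zero_iff (two_ne_zero) |>.1 (le_antisymm h3 (sq_nonneg _))]

/-- The energy form is an inner product on functions of finite energy modulo constants. -/
noncomputable abbrev energyCore : InnerProductSpace.Core ℝ N.EnergySpace where
  inner := N.energyInner
  conj_inner_symm := by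
    intro u v
    obtain ⟨u, rfl⟩ := N.toEnergySpace_surjective u
    obtain ⟨v, rfl⟩ := N.toEnergySpace_surjective v
    simp only [energyInner_mk, energy, conj_trivial]
    congr 2
    funext p
    ring
  re_inner_nonneg := by
    intro u
    obtain ⟨u, rfl⟩ := N.toEnergySpace_surjective u
    have h := N.sum_le_energy u ∅
    simp only [Finset.sum_empty] at h
    simp only [energyInner_mk, RCLike.re_to_real]
    linarith
  add_left := by
    intro u v w
    obtain ⟨u, rfl⟩ := N.toEnergySpace_surjective u
    obtain ⟨v, rfl⟩ := N.toEnergySpace_surjective v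
    obtain ⟨w, rfl⟩ := N.toEnergySpace_surjective w
    rw [← map_add]
    simp only [energyInner_mk, energy]
    rw [← mul_add, ← (N.summable_mul u.2 w.2).tsum_add (N.summable_mul v.2 w.2)]
    congr 2
    funext p
    simp only [Submodule.coe_add, Pi.add_apply]
    ring
  smul_left := by
    intro u v a
    obtain ⟨u, rfl⟩ := N.toEnergySpace_surjective u
    obtain ⟨v, rfl⟩ := N.toEnergySpace_surjective v
    rw [← map_smul]
    simp only [energyInner_mk, energy, conj_trivial]
    rw [mul_left_comm, ← tsum_mul_left (a := a)]
    congr 2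
    funext p
    simp only [Submodule.coe_smul, Pi.smul_apply, smul_eq_mul]
    ring
  definite := by
    intro u
    obtain ⟨u, rfl⟩ := N.toEnergySpace_surjective u
    intro hu
    have h := N.eq_of_energy_eq_zero u hu
    refine (Submodule.Quotient.mk_eq_zero _).2 (Submodule.mem_comap.2 ?_)
    obtain ⟨o⟩ := N.connected.nonempty
    refine Submodule.mem_span_singleton.2 ⟨(u : V → ℝ) o, ?_⟩
    funext x
    simp [h o x]

noncomputable instance : NormedAddCommGroup N.EnergySpace :=
  N.energyCore.toNormedAddCommGroup

noncomputable instance : InnerProductSpace ℝ N.EnergySpace :=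
  InnerProductSpace.ofCore N.energyCore.toCore

lemma inner_mk (u v : N.energyDomain) :
    inner ℝ (N.toEnergySpace u) (N.toEnergySpace v) = N.energy u v := rfl

lemma norm_sq_mk (u : N.energyDomain) : ‖N.toEnergySpace u‖ ^ 2 = N.energy u u := by
  rw [← N.inner_mk, real_inner_self_eq_norm_sq]

lemma continuous_diffₗ (x y : V) : Continuous (N.diffₗ x y) := by
  obtain ⟨w⟩ := N.connected.preconnected x y
  induction w with
  | nil =>
    refine continuous_const.congr (f := fun _ => (0 : ℝ)) fun u => ?_
    obtain ⟨u, rfl⟩ := N.toEnergySpace_surjective u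
    simp [diffₗ_mk]
  | @cons a b d h _ ih =>
    have hab : Continuous (N.diffₗ a b) := by
      have hc : 0 < N.c a b := h
      refine AddMonoidHomClass.continuous_of_bound (N.diffₗ a b) (√(2 / N.c a b)) fun u => ?_
      obtain ⟨u, rfl⟩ := N.toEnergySpace_surjective u
      rw [diffₗ_mk, Real.norm_eq_abs]
      refine abs_le_of_sq_le_sq ?_ (by positivity)
      rw [mul_pow, Real.sq_sqrt (by positivity), norm_sq_mk, div_mul_eq_mul_div,
        le_div_iff₀ hc, mul_comm]
      exact N.edge_le_energy u a b
    refine (hab.add ih).congr fun u => ?_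
    obtain ⟨u, rfl⟩ := N.toEnergySpace_surjective u
    simp only [Pi.add_apply, diffₗ_mk]
    ring

/-- The functional `u ↦ u x - u y` is continuous on the energy space. -/
noncomputable def diff (x y : V) : N.EnergySpace →L[ℝ] ℝ :=
  ⟨N.diffₗ x y, N.continuous_diffₗ x y⟩

/-- The energy space is complete, i.e. a Hilbert space. -/
instance : CompleteSpace N.EnergySpace := by
  refine Metric.complete_of_cauchySeq_tendsto fun U hU => ?_
  choose w hw using fun n => N.toEnergySpace_surjective (U n)
  obtain ⟨o⟩ := N.connected.nonempty
  have hlim : ∀ x, ∃ l, Tendsto (fun n => (w n : V → ℝ) x - (w n : V → ℝ) o) atTop (𝓝 l) := by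
    intro x
    refine cauchySeq_tendsto_of_complete ?_
    have h : CauchySeq fun n => N.diff x o (U n) :=
      (N.diff x o).uniformContinuous.comp_cauchySeq hU
    simp only [← hw] at h
    exact h
  choose g hg using hlim
  have key : ∀ ε > 0, ∃ n₀, ∀ n ≥ n₀, ∀ s : Finset (V × V),
      ∑ p ∈ s, N.c p.1 p.2 *
        (((w n : V → ℝ) p.1 - g p.1) - ((w n : V → ℝ) p.2 - g p.2)) ^ 2 ≤ 2 * ε ^ 2 := by
    intro ε hε
    obtain ⟨n₀, h₀⟩ := Metric.cauchySeq_iff.1 hU ε hε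
    refine ⟨n₀, fun n hn s => ?_⟩
    have hT : Tendsto (fun m => ∑ p ∈ s, N.c p.1 p.2 *
        (((w n : V → ℝ) p.1 - ((w m : V → ℝ) p.1 - (w m : V → ℝ) o)) -
          ((w n : V → ℝ) p.2 - ((w m : V → ℝ) p.2 - (w m : V → ℝ) o))) ^ 2) atTop
        (𝓝 (∑ p ∈ s, N.c p.1 p.2 *
        (((w n : V → ℝ) p.1 - g p.1) - ((w n : V → ℝ) p.2 - g p.2)) ^ 2)) :=
      tendsto_finsetSum _ fun p _ => (((tendsto_const_nhds.sub (hg p.1)).sub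
        (tendsto_const_nhds.sub (hg p.2))).pow 2).const_mul _
    refine le_of_tendsto hT ?_
    filter_upwards [eventually_ge_atTop n₀] with m hm
    have h1 := N.sum_le_energy (w n - w m) s
    have h2 : N.energy (w n - w m : N.energyDomain) (w n - w m : N.energyDomain) ≤ ε ^ 2 := by
      rw [← norm_sq_mk, map_sub, hw, hw, ← dist_eq_norm]
      exact pow_le_pow_left₀ dist_nonneg (h₀ n hn m hm).le 2
    refine le_trans (le_of_eq ?_) (h1.trans (by linarith))
    refine Finset.sum_congr rfl fun p _ => ?_
    simp only [Submodule.coe_sub, Pi.sub_apply]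
    ring
  have hmem : ∀ n, (∃ C, ∀ s : Finset (V × V), ∑ p ∈ s, N.c p.1 p.2 *
        (((w n : V → ℝ) p.1 - g p.1) - ((w n : V → ℝ) p.2 - g p.2)) ^ 2 ≤ C) →
      (w n : V → ℝ) - g ∈ N.energyDomain := by
    rintro n ⟨C, hC⟩
    exact summable_of_sum_le (fun p => mul_nonneg (N.nonneg p.1 p.2) (sq_nonneg _)) hC
  have hgdom : g ∈ N.energyDomain := by
    obtain ⟨n, hn⟩ := key 1 one_pos
    have := N.energyDomain.sub_mem (w n).2 (hmem n ⟨_, hn n le_rfl⟩)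
    simpa using this
  refine ⟨N.toEnergySpace ⟨g, hgdom⟩, Metric.tendsto_atTop.2 fun ε hε => ?_⟩
  obtain ⟨n₀, h₀⟩ := key (ε / 2) (half_pos hε)
  refine ⟨n₀, fun n hn => lt_of_le_of_lt ?_ (half_lt_self hε)⟩
  rw [← hw, dist_eq_norm, ← map_sub]
  refine le_of_sq_le_sq ?_ (half_pos hε).le
  rw [norm_sq_mk]
  have hle := (hmem n ⟨_, h₀ n hn⟩).tsum_le_of_sum_le (h₀ n hn)
  have he : N.energy (w n - ⟨g, hgdom⟩ : N.energyDomain) (w n - ⟨g, hgdom⟩ : N.energyDomain) =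
      (1 / 2) * ∑' p : V × V, N.c p.1 p.2 *
        (((w n : V → ℝ) - g) p.1 - ((w n : V → ℝ) - g) p.2) ^ 2 := by
    simp [energy, pow_two]
  rw [he]
  simp only [Pi.sub_apply] at hle ⊢
  linarith

/-- The energy kernel: `v_x` is the Riesz representative of `u ↦ u x - u o`. -/
noncomputable def energyKernel (o x : V) : N.EnergySpace :=
  (InnerProductSpace.toDual ℝ N.EnergySpace).symm (N.diff x o)

/-- The characteristic property `⟨v_x, u⟩ = u x - u o` of the energy kernel. -/
lemma inner_energyKernel (o x : V) (u : N.energyDomain) :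
    inner ℝ (N.energyKernel o x) (N.toEnergySpace u) = (u : V → ℝ) x - (u : V → ℝ) o := by
  rw [energyKernel, InnerProductSpace.toDual_symm_apply]
  rfl

/-- The classes of functions of finite energy that are constant off a finite set. -/
noncomputable def finiteSupport : Submodule ℝ N.EnergySpace :=
  Submodule.map N.toEnergySpace
    { carrier := {u | ∃ k : ℝ, {x | (u : V → ℝ) x ≠ k}.Finite}
      zero_mem' := ⟨0, by simp⟩
      add_mem' := by
        rintro u v ⟨k, hk⟩ ⟨l, hl⟩
        refine ⟨k + l, (hk.union hl).subset fun x hx => ?_⟩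
        by_contra h
        simp only [Set.mem_union, Set.mem_ofPred_eq, not_or, not_not] at h
        exact hx (by simp [h.1, h.2])
      smul_mem' := by
        rintro a u ⟨k, hk⟩
        refine ⟨a * k, hk.subset fun x hx => ?_⟩
        intro h
        exact hx (by simp [h]) }

/-- The space `Fin`: the closure, in energy, of the finitely supported functions. -/
noncomputable def FinSpace : Submodule ℝ N.EnergySpace := N.finiteSupport.topologicalClosure

instance : CompleteSpace N.FinSpace :=
  N.finiteSupport.isClosed_topologicalClosure.completeSpace_coe

/-- `f_x`, the orthogonal projection of `v_x` to `Fin`. -/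
noncomputable def finKernel (o x : V) : N.FinSpace := N.FinSpace.orthogonalProjectionOnto (N.energyKernel o x)

end ResistanceNetwork

namespace ResistanceNetwork

variable {V : Type*} (N : ResistanceNetwork V)

/-! ### Exhaustions -/

/-! The wired network on `H` is a finite-dimensional slice of the energy space. Grounding its
voltage at `∞` and extending by zero gives a function supported in `H`, and Kirchhoff's law at `a ∈
H` becomes the pairing with the Dirac function at `a` (`energy_dirac`). So the unit-current voltage
from `x` to `y` is the projection of the kernel `energyKernel y x` to `supportedIn H`, and its
voltage drop is the squared norm of that projection (`wiredSubnetworkResistance_eq`).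

Along an exhaustion these subspaces increase to the finitely supported classes. The projections
therefore converge to the projection to `FinSpace` (`tendsto_potential`), so the limit is
`‖finKernel y x‖ ^ 2` for every exhaustion. Changing the origin shifts all `f_x` by a common vector
(`finKernel_sub`), which gives the distance formula; Dirac functions separate points.

A squared Hilbert norm need not obey the triangle inequality. Here it does because the inner
products of the `f_x` are nonnegative (`inner_finKernel_nonneg`), a consequence of the minimum
principle. -/

lemma countable_vertices {V : Type*} (N : ResistanceNetwork V) : Countable V := by
  obtain ⟨o⟩ := N.connected.nonempty
  have hball : ∀ n : ℕ, {x | ∃ w : N.graph.Walk x o, w.length = n}.Countable := by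
    intro n
    induction n with
    | zero =>
      refine (Set.countable_singleton o).mono ?_
      rintro x ⟨w, hw⟩
      exact SimpleGraph.Walk.eq_of_length_eq_zero hw
    | succ n ih =>
      -- A summable family has countable support, so each vertex has countably many neighbours even
      -- without local finiteness.
      refine (ih.biUnion fun y _ => (N.summable y).countable_support).mono ?_
      rintro x ⟨w, hw⟩
      cases w with
      | nil => simp at hw
      | @cons _ b _ h p =>
        have h' : 0 < N.c x b := h
        simp only [SimpleGraph.Walk.length_cons, Nat.add_right_cancel_iff] at hw
        refine Set.mem_biUnion (show b ∈ {x | ∃ w : N.graph.Walk x o, w.length = n} from ⟨p, hw⟩) ?_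
        rw [Function.mem_support, N.symm]
        exact h'.ne'
  refine Set.countable_univ_iff.1 ((Set.countable_iUnion hball).mono fun x _ => ?_)
  obtain ⟨w⟩ := N.connected.preconnected x o
  exact Set.mem_iUnion.2 ⟨w.length, w, rfl⟩

lemma exists_isExhaustion : ∃ G : ℕ → Finset V, N.IsExhaustion G := by
  classical
  have := N.countable_vertices
  have := N.connected.nonempty
  obtain ⟨e, he⟩ := exists_surjective_nat V
  have hext : ∀ s : Finset V, s.Nonempty →
      ∃ t : Finset V, s ⊆ t ∧ (N.graph.induce (t : Set V)).Connected :=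
    fun s hs => SimpleGraph.extend_finset_to_connected N.connected.preconnected hs
  choose! E hE hEc using hext
  let G : ℕ → Finset V := fun n => Nat.rec (E {e 0}) (fun n s => E (insert (e (n + 1)) s)) n
  have hsub : ∀ n, insert (e (n + 1)) (G n) ⊆ G (n + 1) := fun n => hE _ (Finset.insert_nonempty _ _)
  refine ⟨G, monotone_nat_of_le_succ fun n => (Finset.subset_insert _ _).trans (hsub n), ?_, ?_⟩
  · rintro (_ | n)
    · exact hEc _ (Finset.singleton_nonempty _)
    · exact hEc _ (Finset.insert_nonempty _ _)
  · intro x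
    obtain ⟨n, rfl⟩ := he x
    refine ⟨n, ?_⟩
    cases n with
    | zero => exact hE _ (Finset.singleton_nonempty _) (Finset.mem_singleton_self _)
    | succ n => exact hsub n (Finset.mem_insert_self _ _)

/-! ### Dirac functions -/

/-- The bound `|t| ≤ 1 + t ^ 2` dominates the Laplacian at `a` by the total conductance and the
energy of the edges at `a`. -/
lemma summable_mul_sub (u : N.energyDomain) (a : V) :
    Summable fun y => N.c a y * ((u : V → ℝ) a - (u : V → ℝ) y) := by
  have h2 : Summable fun y => N.c a y * ((u : V → ℝ) a - (u : V → ℝ) y) ^ 2 :=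
    u.2.comp_injective (i := fun y : V => (a, y)) fun y z h => (Prod.ext_iff.1 h).2
  refine Summable.of_norm_bounded ((N.summable a).add h2) fun y => ?_
  have h := N.nonneg a y
  rw [Real.norm_eq_abs, abs_mul, abs_of_nonneg h]
  nlinarith [sq_nonneg (|(u : V → ℝ) a - (u : V → ℝ) y| - 1), abs_nonneg ((u : V → ℝ) a - (u : V → ℝ) y),
    sq_abs ((u : V → ℝ) a - (u : V → ℝ) y)]

open Classical in
lemma single_mem_energyDomain (a : V) : (Pi.single a (1 : ℝ) : V → ℝ) ∈ N.energyDomain := by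
  have h1 : Summable fun p : V × V => if p.1 = a then N.c p.1 p.2 else 0 := by
    have hi : Function.Injective fun y : V => (a, y) := fun y z h => (Prod.ext_iff.1 h).2
    refine (hi.summable_iff ?_).1 ((N.summable a).congr fun y => by simp)
    rintro ⟨p, q⟩ hp
    refine if_neg ?_
    rintro rfl
    exact hp ⟨q, rfl⟩
  have h2 : Summable fun p : V × V => if p.2 = a then N.c p.1 p.2 else 0 := by
    refine ((Equiv.prodComm V V).summable_iff.2 h1).congr fun p => ?_
    simp [N.symm]
  refine Summable.of_nonneg_of_le (fun p => mul_nonneg (N.nonneg _ _) (sq_nonneg _)) (fun p => ?_)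
    (h1.add h2)
  have h := N.nonneg p.1 p.2
  by_cases hp : p.1 = a <;> by_cases hq : p.2 = a <;> simp [hp, hq]
  exact N.nonneg _ _

open Classical in
/-- The Dirac function at `a`. -/
noncomputable def dirac (a : V) : N.energyDomain := ⟨Pi.single a 1, N.single_mem_energyDomain a⟩

open Classical in
/-- Pairing with a Dirac function computes the Laplacian. -/
lemma energy_dirac (u : N.energyDomain) (a : V) :
    N.energy u (N.dirac a) = ∑' y, N.c a y * ((u : V → ℝ) a - (u : V → ℝ) y) := by
  set f : V → ℝ := fun y => N.c a y * ((u : V → ℝ) a - (u : V → ℝ) y) with hf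
  have hi : Function.Injective fun y : V => (a, y) := fun y z h => (Prod.ext_iff.1 h).2
  have h1 : HasSum (fun p : V × V => if p.1 = a then f p.2 else 0) (∑' y, f y) := by
    refine (hi.hasSum_iff ?_).1 ((N.summable_mul_sub u a).hasSum.congr_fun fun y => ?_)
    · rintro ⟨p, q⟩ hp
      refine if_neg ?_
      rintro rfl
      exact hp ⟨q, rfl⟩
    · simp [hf]
  have h2 : HasSum (fun p : V × V => if p.2 = a then f p.1 else 0) (∑' y, f y) :=
    (Equiv.prodComm V V).hasSum_iff.2 h1
  -- Each edge at `a` occurs in both orientations, which cancels the factor `1 / 2`; the pair `(a,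
  -- a)` contributes zero.
  rw [energy, (((h1.add h2).congr_fun fun p => ?_) : HasSum (fun p : V × V => N.c p.1 p.2 *
    (((u : V → ℝ) p.1 - (u : V → ℝ) p.2) *
      ((N.dirac a : V → ℝ) p.1 - (N.dirac a : V → ℝ) p.2))) _).tsum_eq]
  · ring
  · by_cases hp : p.1 = a <;> by_cases hq : p.2 = a <;>
      simp [dirac, hp, hq, hf]
    exact Or.inl (N.symm _ _)

/-! ### Functions supported in a finite set -/

/-- The classes of functions that vanish off the finite set `H`. -/
noncomputable def supportedIn (H : Finset V) : Submodule ℝ N.EnergySpace :=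
  Submodule.span ℝ ((fun a => N.toEnergySpace (N.dirac a)) '' (H : Set V))

instance (H : Finset V) : FiniteDimensional ℝ (N.supportedIn H) :=
  FiniteDimensional.span_of_finite ℝ (H.finite_toSet.image _)

lemma supportedIn_mono : Monotone N.supportedIn := fun _ _ h =>
  Submodule.span_mono (Set.image_mono (Finset.coe_subset.2 h))

lemma dirac_mem_supportedIn {H : Finset V} {a : V} (ha : a ∈ H) :
    N.toEnergySpace (N.dirac a) ∈ N.supportedIn H :=
  Submodule.subset_span ⟨a, ha, rfl⟩

lemma eq_sum_dirac {H : Finset V} {t : V → ℝ} (ht : ∀ x ∉ H, t x = 0) :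
    t = ((∑ a ∈ H, t a • N.dirac a : N.energyDomain) : V → ℝ) := by
  classical
  funext x
  simp only [Submodule.coe_sum, Submodule.coe_smul, dirac, Finset.sum_apply, Pi.smul_apply,
    Pi.single_apply, smul_eq_mul, mul_ite, mul_one, mul_zero, Finset.sum_ite_eq]
  split_ifs with h
  · rfl
  · exact ht x h

lemma mem_energyDomain_of_support {H : Finset V} {t : V → ℝ} (ht : ∀ x ∉ H, t x = 0) :
    t ∈ N.energyDomain := by
  rw [N.eq_sum_dirac ht]
  exact Subtype.property _

lemma toEnergySpace_eq_of_sub_const {u v : N.energyDomain} {k : ℝ}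
    (h : ∀ x, (u : V → ℝ) x - (v : V → ℝ) x = k) : N.toEnergySpace u = N.toEnergySpace v := by
  refine (Submodule.Quotient.eq _).2 (Submodule.mem_comap.2 (Submodule.mem_span_singleton.2 ⟨k, ?_⟩))
  funext x
  simp [h x]

/-- Modulo constants, the value off `H` may be shifted to zero; this is the freedom to ground the
vertex `∞`. -/
lemma mem_supportedIn_of_const {H : Finset V} (u : N.energyDomain) {k : ℝ}
    (hu : ∀ x ∉ H, (u : V → ℝ) x = k) : N.toEnergySpace u ∈ N.supportedIn H := by
  have h0 : ∀ x ∉ H, (u : V → ℝ) x - k = 0 := fun x hx => sub_eq_zero.2 (hu x hx)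
  have h1 := N.eq_sum_dirac (t := fun x => (u : V → ℝ) x - k) h0
  rw [N.toEnergySpace_eq_of_sub_const (v := ∑ a ∈ H, ((u : V → ℝ) a - k) • N.dirac a) (k := k)]
  · rw [map_sum]
    refine Submodule.sum_mem _ fun a ha => ?_
    rw [map_smul]
    exact Submodule.smul_mem _ _ (N.dirac_mem_supportedIn ha)
  · intro x
    rw [← congrFun h1 x]
    ring

lemma exists_rep_of_mem_supportedIn {H : Finset V} {g : N.EnergySpace} (hg : g ∈ N.supportedIn H) :
    ∃ u : N.energyDomain, (∀ x ∉ H, (u : V → ℝ) x = 0) ∧ N.toEnergySpace u = g := by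
  classical
  induction hg using Submodule.span_induction with
  | mem g hg =>
    obtain ⟨a, ha, rfl⟩ := hg
    refine ⟨N.dirac a, fun x hx => ?_, rfl⟩
    have : x ≠ a := fun h => hx (h ▸ ha)
    simp [dirac, this]
  | zero => exact ⟨0, by simp, map_zero _⟩
  | add g h _ _ ihg ihh =>
    obtain ⟨u, hu, rfl⟩ := ihg
    obtain ⟨v, hv, rfl⟩ := ihh
    exact ⟨u + v, fun x hx => by simp [hu x hx, hv x hx], map_add _ _ _⟩
  | smul k g _ ih =>
    obtain ⟨u, hu, rfl⟩ := ih
    exact ⟨k • u, fun x hx => by simp [hu x hx], map_smul _ _ _⟩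

lemma supportedIn_le_finiteSupport (H : Finset V) : N.supportedIn H ≤ N.finiteSupport := by
  intro g hg
  obtain ⟨u, hu, rfl⟩ := N.exists_rep_of_mem_supportedIn hg
  refine Submodule.mem_map_of_mem ⟨0, H.finite_toSet.subset fun x hx => ?_⟩
  by_contra h
  exact hx (hu x h)

lemma IsExhaustion.subset {N : ResistanceNetwork V} {G : ℕ → Finset V} (hG : N.IsExhaustion G)
    (S : Finset V) : ∃ k, S ⊆ G k := by
  classical
  induction S using Finset.induction_on with
  | empty => exact ⟨0, Finset.empty_subset _⟩
  | insert a S _ ih =>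
    obtain ⟨k, hk⟩ := ih
    obtain ⟨l, hl⟩ := hG.exhausts a
    exact ⟨max k l, Finset.insert_subset (hG.monotone (le_max_right k l) hl)
      (hk.trans (hG.monotone (le_max_left k l)))⟩

lemma IsExhaustion.iSup_supportedIn {N : ResistanceNetwork V} {G : ℕ → Finset V}
    (hG : N.IsExhaustion G) : ⨆ k, N.supportedIn (G k) = N.finiteSupport := by
  refine le_antisymm (iSup_le fun k => N.supportedIn_le_finiteSupport _) ?_
  rintro _ ⟨u, ⟨l, hl⟩, rfl⟩
  obtain ⟨k, hk⟩ := hG.subset hl.toFinset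
  refine (le_iSup (fun k => N.supportedIn (G k)) k) (N.mem_supportedIn_of_const u (k := l) ?_)
  intro x hx
  by_contra h
  exact hx (hk (hl.mem_toFinset.2 h))

/-! ### Resistance in a wired subnetwork -/

/-- The Laplacian of the wired subnetwork at a vertex of `H`, for a function that vanishes at `∞`. -/
lemma sum_wiredConductance_some {H : Finset V} (u : N.energyDomain)
    (hu : ∀ x ∉ H, (u : V → ℝ) x = 0) (v : Option H → ℝ) (hv : ∀ a : H, v (some a) = (u : V → ℝ) a)
    (hv0 : v none = 0) (a : H) :
    ∑ w, N.wiredConductance H (some a) w * (v (some a) - v w) = N.energy u (N.dirac a) := by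
  rw [energy_dirac, ← (N.summable_mul_sub u a).sum_add_tsum_subtype_compl H, Fintype.sum_option,
    add_comm]
  congr 1
  · rw [← Finset.sum_coe_sort H]
    simp [wiredConductance, hv]
  · rw [hv0, sub_zero, hv, wiredConductance, ← tsum_mul_right]
    exact tsum_congr fun y => by rw [hu y y.2, sub_zero]

lemma wiredConductance_comm (H : Finset V) (z w : Option H) :
    N.wiredConductance H z w = N.wiredConductance H w z := by
  cases z <;> cases w <;> simp [wiredConductance, N.symm]

/-- The Laplacian of a function on a finite network has total mass zero. -/
lemma sum_laplacian_eq_zero {W : Type*} [Fintype W] (c : W → W → ℝ) (hc : ∀ z w, c z w = c w z)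
    (v : W → ℝ) : ∑ z, ∑ w, c z w * (v z - v w) = 0 := by
  have h : ∑ z, ∑ w, c z w * (v z - v w) = -∑ z, ∑ w, c z w * (v z - v w) := by
    conv_lhs => rw [Finset.sum_comm]
    simp only [← Finset.sum_neg_distrib]
    refine Finset.sum_congr rfl fun z _ => Finset.sum_congr rfl fun w _ => ?_
    rw [hc w z]
    ring
  linarith

/-- The voltage of the unit current flow from `x` to `y` in the wired network on `H`, as the
projection of the energy kernel. -/
noncomputable def potential (H : Finset V) (x y : V) : N.EnergySpace :=
  (N.supportedIn H).starProjection (N.energyKernel y x)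

lemma potential_mem (H : Finset V) (x y : V) : N.potential H x y ∈ N.supportedIn H :=
  Submodule.starProjection_apply_mem _ _

/-- Projections are self-adjoint, so the potential is the reproducing element of `supportedIn H` for
the difference between `x` and `y`. -/
lemma inner_potential {H : Finset V} (x y : V) {g : N.EnergySpace} (hg : g ∈ N.supportedIn H) :
    inner ℝ (N.potential H x y) g = inner ℝ (N.energyKernel y x) g := by
  rw [potential, Submodule.inner_starProjection_left_eq_right,
    Submodule.starProjection_eq_self_iff.2 hg]

lemma inner_energyKernel_dirac (x y a : V) :
    inner ℝ (N.energyKernel y x) (N.toEnergySpace (N.dirac a)) =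
      Set.indicator {x} (fun _ => (1 : ℝ)) a - Set.indicator {y} (fun _ => (1 : ℝ)) a := by
  classical
  rw [inner_energyKernel]
  simp [dirac, Pi.single_apply, Set.indicator_apply, eq_comm]

/-- Kirchhoff's law at the vertices of `H` says that the kernel minus `u` is orthogonal to the Dirac
functions spanning `supportedIn H`, which characterizes the projection. -/
lemma eq_potential {H : Finset V} (x y : V) {u : N.energyDomain}
    (hu : ∀ x ∉ H, (u : V → ℝ) x = 0)
    (h : ∀ a ∈ H, N.energy u (N.dirac a) =
      Set.indicator {x} (fun _ => (1 : ℝ)) a - Set.indicator {y} (fun _ => (1 : ℝ)) a) :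
    N.toEnergySpace u = N.potential H x y := by
  refine (Submodule.eq_starProjection_of_mem_of_inner_eq_zero (N.mem_supportedIn_of_const u hu)
    fun g hg => ?_).symm
  induction hg using Submodule.span_induction with
  | mem g hg =>
    obtain ⟨a, ha, rfl⟩ := hg
    rw [inner_sub_left, inner_energyKernel_dirac, inner_mk, h a ha, sub_self]
  | zero => exact inner_zero_right _
  | add g h _ _ ihg ihh => rw [inner_add_right, ihg, ihh, add_zero]
  | smul k g _ ih => rw [inner_smul_right, ih, mul_zero]

lemma potential_diff_eq_norm_sq {H : Finset V} (x y : V) {u : N.energyDomain}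
    (hu : N.toEnergySpace u = N.potential H x y) :
    (u : V → ℝ) x - (u : V → ℝ) y = ‖N.potential H x y‖ ^ 2 := by
  rw [← inner_energyKernel, hu, ← N.inner_potential x y (N.potential_mem H x y),
    real_inner_self_eq_norm_sq]

lemma indicator_some {H : Finset V} {x : V} (hx : x ∈ H) (a : H) :
    Set.indicator {some (⟨x, hx⟩ : H)} (fun _ => (1 : ℝ)) (some a) =
      Set.indicator {x} (fun _ => (1 : ℝ)) (a : V) := by
  classical
  simp [Set.indicator_apply, Subtype.ext_iff]

/-- A solution of Kirchhoff's law in the wired network has voltage drop `‖P v‖²`. -/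
lemma voltage_drop_eq {H : Finset V} {x y : V} (hx : x ∈ H) (hy : y ∈ H) (v : Option H → ℝ)
    (hv : ∀ z, ∑ w, N.wiredConductance H z w * (v z - v w) =
      Set.indicator {some (⟨x, hx⟩ : H)} (fun _ => (1 : ℝ)) z -
        Set.indicator {some (⟨y, hy⟩ : H)} (fun _ => (1 : ℝ)) z) :
    v (some ⟨x, hx⟩) - v (some ⟨y, hy⟩) = ‖N.potential H x y‖ ^ 2 := by
  classical
  -- Ground the voltage at `∞` and extend by zero; the Laplacian sees only differences.
  let t : V → ℝ := fun a => if h : a ∈ H then v (some ⟨a, h⟩) - v none else 0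
  have ht : ∀ a ∉ H, t a = 0 := fun a ha => dif_neg ha
  have ht' : ∀ a : H, v (some a) - v none = t a := fun a => by simp [t]
  let u : N.energyDomain := ⟨t, N.mem_energyDomain_of_support ht⟩
  have h := N.eq_potential x y (u := u) ht fun a ha => by
    rw [← N.sum_wiredConductance_some u ht (fun z => v z - v none) ht' (sub_self _) ⟨a, ha⟩]
    simp only [sub_sub_sub_cancel_right]
    rw [hv, indicator_some, indicator_some]
  have h' := N.potential_diff_eq_norm_sq x y h
  rw [← h']
  change _ = t x - t y
  rw [← ht' ⟨x, hx⟩, ← ht' ⟨y, hy⟩]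
  ring

lemma exists_voltage {H : Finset V} {x y : V} (hx : x ∈ H) (hy : y ∈ H) :
    ∃ v : Option H → ℝ, ∀ z, ∑ w, N.wiredConductance H z w * (v z - v w) =
      Set.indicator {some (⟨x, hx⟩ : H)} (fun _ => (1 : ℝ)) z -
        Set.indicator {some (⟨y, hy⟩ : H)} (fun _ => (1 : ℝ)) z := by
  obtain ⟨u, hu, hP⟩ := N.exists_rep_of_mem_supportedIn (N.potential_mem H x y)
  let v : Option H → ℝ := fun z => z.elim 0 fun a => (u : V → ℝ) a
  have hsome : ∀ a : H, ∑ w, N.wiredConductance H (some a) w * (v (some a) - v w) =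
      Set.indicator {some (⟨x, hx⟩ : H)} (fun _ => (1 : ℝ)) (some a) -
        Set.indicator {some (⟨y, hy⟩ : H)} (fun _ => (1 : ℝ)) (some a) := fun a => by
    rw [N.sum_wiredConductance_some u hu v (fun _ => rfl) rfl, indicator_some, indicator_some,
      ← inner_energyKernel_dirac, ← inner_mk, hP, N.inner_potential x y (N.dirac_mem_supportedIn a.2)]
  refine ⟨v, ?_⟩
  rintro (_ | a)
  -- The equation at `∞` follows from the others: both sides have total mass zero.
  · have h := sum_laplacian_eq_zero (N.wiredConductance H) (N.wiredConductance_comm H) v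
    have hmass : ∀ b : H, ∑ a : H, Set.indicator {some b} (fun _ => (1 : ℝ)) (some a) = 1 := by
      classical
      intro b
      simp [Set.indicator_apply]
    rw [Fintype.sum_option, Finset.sum_congr rfl fun a _ => hsome a, Finset.sum_sub_distrib,
      hmass, hmass, sub_self, add_zero] at h
    rw [h]
    simp
  · exact hsome a

lemma wiredSubnetworkResistance_eq {H : Finset V} {x y : V} (hx : x ∈ H) (hy : y ∈ H) :
    N.wiredSubnetworkResistance H x y = ‖N.potential H x y‖ ^ 2 := by
  obtain ⟨v, hv⟩ := N.exists_voltage hx hy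
  rw [wiredSubnetworkResistance, dif_pos ⟨hx, hy⟩, effectiveResistance]
  obtain ⟨v', hv', h⟩ := Classical.epsilon_spec (p := fun r : ℝ => ∃ v : Option H → ℝ,
    (∀ z, ∑ w, N.wiredConductance H z w * (v z - v w) =
      Set.indicator {some (⟨x, hx⟩ : H)} (fun _ => (1 : ℝ)) z -
        Set.indicator {some (⟨y, hy⟩ : H)} (fun _ => (1 : ℝ)) z) ∧
    v (some ⟨x, hx⟩) - v (some ⟨y, hy⟩) = r) ⟨_, v, hv, rfl⟩
  exact h.symm.trans (N.voltage_drop_eq hx hy v' hv')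

/-! ### The limit -/

/-- Both sides represent `u ↦ u x - u y`; the origin cancels. -/
lemma energyKernel_sub (o x y : V) :
    N.energyKernel o x - N.energyKernel o y = N.energyKernel y x := by
  rw [energyKernel, energyKernel, energyKernel, ← map_sub]
  congr 1
  ext u
  obtain ⟨u, rfl⟩ := N.toEnergySpace_surjective u
  change N.diffₗ x o _ - N.diffₗ y o _ = N.diffₗ x y _
  simp only [diffₗ_mk]
  ring

lemma finKernel_sub (o x y : V) :
    N.finKernel o x - N.finKernel o y = N.finKernel y x := by
  rw [finKernel, finKernel, finKernel, ← map_sub, energyKernel_sub]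

lemma tendsto_potential {G : ℕ → Finset V} (hG : N.IsExhaustion G) (x y : V) :
    Tendsto (fun k => N.potential (G k) x y) atTop (𝓝 (N.finKernel y x : N.EnergySpace)) := by
  have hE := hG.iSup_supportedIn
  have : (⨆ k, N.supportedIn (G k)).topologicalClosure.HasOrthogonalProjection := by
    rw [hE]
    exact inferInstanceAs N.FinSpace.HasOrthogonalProjection
  have h := Submodule.starProjection_tendsto_closure_iSup (fun k => N.supportedIn (G k))
    (N.supportedIn_mono.comp hG.monotone) (N.energyKernel y x)
  -- Stated for a variable `S`, since the projection instance depends on the subspace being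
  -- replaced.
  have hproj : ∀ (S : Submodule ℝ N.EnergySpace) [S.topologicalClosure.HasOrthogonalProjection],
      S = N.finiteSupport →
        S.topologicalClosure.starProjection (N.energyKernel y x) = N.finKernel y x := by
    rintro S _ rfl
    rfl
  rwa [hproj _ hE] at h

lemma eventually_mem {G : ℕ → Finset V} (hG : N.IsExhaustion G) (x : V) :
    ∀ᶠ k in atTop, x ∈ G k := by
  obtain ⟨k, hk⟩ := hG.exhausts x
  filter_upwards [eventually_ge_atTop k] with l hl
  exact hG.monotone hl hk

lemma tendsto_wiredSubnetworkResistance {G : ℕ → Finset V} (hG : N.IsExhaustion G) (x y : V) :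
    Tendsto (fun k => N.wiredSubnetworkResistance (G k) x y) atTop (𝓝 (‖N.finKernel y x‖ ^ 2)) := by
  refine ((N.tendsto_potential hG x y).norm.pow 2).congr' ?_
  filter_upwards [N.eventually_mem hG x, N.eventually_mem hG y] with k hx hy
  exact (N.wiredSubnetworkResistance_eq hx hy).symm

lemma wiredResistance_eq (x y : V) : N.wiredResistance x y = ‖N.finKernel y x‖ ^ 2 := by
  -- Without an exhaustion the defining property would hold vacuously for every real number.
  obtain ⟨G, hG⟩ := N.exists_isExhaustion
  have h := Classical.epsilon_spec (p := fun r : ℝ => ∀ G : ℕ → Finset V, N.IsExhaustion G →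
    Tendsto (fun k => N.wiredSubnetworkResistance (G k) x y) atTop (𝓝 r))
    ⟨_, fun G hG => N.tendsto_wiredSubnetworkResistance hG x y⟩
  exact tendsto_nhds_unique (h G hG) (N.tendsto_wiredSubnetworkResistance hG x y)

lemma wiredResistance_eq_norm_sub_sq (o x y : V) :
    N.wiredResistance x y = ‖N.finKernel o x - N.finKernel o y‖ ^ 2 := by
  rw [finKernel_sub, wiredResistance_eq]

/-- The Dirac function at `x` lies in `FinSpace` and pairs to `1` with `energyKernel y x` when `x ≠
y`, so the projection of that kernel cannot vanish. -/
lemma finKernel_injective (o : V) : Function.Injective (N.finKernel o) := by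
  classical
  intro x y hxy
  by_contra hne
  have h0 : N.finKernel y x = 0 := by rw [← N.finKernel_sub o, hxy, sub_self]
  have hmem : N.toEnergySpace (N.dirac x) ∈ N.FinSpace :=
    N.finiteSupport.le_topologicalClosure
      (N.supportedIn_le_finiteSupport {x} (N.dirac_mem_supportedIn (Finset.mem_singleton_self x)))
  have h1 := N.inner_energyKernel_dirac x y x
  have horth := (Submodule.orthogonalProjectionOnto_eq_zero_iff (K := N.FinSpace)).1 h0
  rw [real_inner_comm, (Submodule.mem_orthogonal _ _).1 horth _ hmem] at h1
  simp [hne] at h1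

/-! ### The triangle inequality -/

/-- Truncation `t ↦ max t m` is 1-Lipschitz, so it decreases the energy edge by edge. -/
lemma energy_max_le (u : N.energyDomain) (m : ℝ) :
    ∃ w : N.energyDomain, (∀ x, (w : V → ℝ) x = max ((u : V → ℝ) x) m) ∧
      N.energy w w ≤ N.energy u u := by
  have hle : ∀ p : V × V, N.c p.1 p.2 * (max ((u : V → ℝ) p.1) m - max ((u : V → ℝ) p.2) m) ^ 2 ≤
      N.c p.1 p.2 * ((u : V → ℝ) p.1 - (u : V → ℝ) p.2) ^ 2 := fun p =>
    mul_le_mul_of_nonneg_left (sq_le_sq.2 (abs_max_sub_max_le_abs _ _ _)) (N.nonneg _ _)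
  have hs : Summable fun p : V × V =>
      N.c p.1 p.2 * (max ((u : V → ℝ) p.1) m - max ((u : V → ℝ) p.2) m) ^ 2 :=
    Summable.of_nonneg_of_le (fun p => mul_nonneg (N.nonneg _ _) (sq_nonneg _)) hle u.2
  refine ⟨⟨fun x => max ((u : V → ℝ) x) m, hs⟩, fun x => rfl, ?_⟩
  simp only [energy, ← pow_two]
  exact mul_le_mul_of_nonneg_left (hs.tsum_le_tsum hle u.2) (by norm_num)

/-- The minimum principle: the potential of a unit flow is smallest at the sink. -/
lemma diff_potential_nonneg {H : Finset V} (x y z : V) :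
    0 ≤ N.diff z y (N.potential H x y) := by
  obtain ⟨u, hu, hP⟩ := N.exists_rep_of_mem_supportedIn (N.potential_mem H x y)
  -- Cut off below at the value at the sink. The truncation `w` has no more energy than `u` and at
  -- least its drop from `x` to `y`, which forces `‖u - w‖ ^ 2 ≤ 0`; hence `u` never goes below its
  -- value at `y`.
  obtain ⟨w, hw, hE⟩ := N.energy_max_le u ((u : V → ℝ) y)
  have hwmem : N.toEnergySpace w ∈ N.supportedIn H :=
    N.mem_supportedIn_of_const w (k := max 0 ((u : V → ℝ) y)) fun a ha => by rw [hw, hu a ha]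
  have h1 : inner ℝ (N.toEnergySpace u) (N.toEnergySpace w) = (w : V → ℝ) x - (w : V → ℝ) y := by
    rw [hP, N.inner_potential x y hwmem, inner_energyKernel]
  have h2 : ‖N.toEnergySpace u‖ ^ 2 = (u : V → ℝ) x - (u : V → ℝ) y := by
    rw [hP, N.potential_diff_eq_norm_sq x y hP]
  have h3 : ‖N.toEnergySpace u - N.toEnergySpace w‖ ^ 2 ≤ 0 := by
    have h4 : (u : V → ℝ) x ≤ (w : V → ℝ) x := hw x ▸ le_max_left _ _
    have h5 : (w : V → ℝ) y = (u : V → ℝ) y := by rw [hw, max_self]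
    rw [norm_sub_sq_real, h1]
    rw [← norm_sq_mk, ← norm_sq_mk] at hE
    linarith
  have h6 : N.toEnergySpace u = N.toEnergySpace w :=
    sub_eq_zero.1 (norm_eq_zero.1 (pow_eq_zero_iff two_ne_zero |>.1 (le_antisymm h3 (sq_nonneg _))))
  change 0 ≤ N.diffₗ z y _
  rw [← hP, h6, diffₗ_mk, hw, hw, max_self]
  exact sub_nonneg.2 (le_max_right _ _)

/-- With origin `y`, the inner product is `f_x z - f_x y`, a limit of the differences in
`diff_potential_nonneg`. -/
lemma inner_finKernel_nonneg (x y z : V) : 0 ≤ inner ℝ (N.finKernel y x) (N.finKernel y z) := by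
  obtain ⟨G, hG⟩ := N.exists_isExhaustion
  have h : inner ℝ (N.finKernel y x) (N.finKernel y z) = N.diff z y (N.finKernel y x) := by
    rw [finKernel, finKernel, Submodule.inner_orthogonalProjectionOnto_eq_of_mem_left,
      real_inner_comm, energyKernel, InnerProductSpace.toDual_symm_apply]
  rw [h]
  exact ge_of_tendsto' (((N.diff z y).continuous.tendsto _).comp (N.tendsto_potential hG x y))
    fun k => N.diff_potential_nonneg x y z

/-- With the middle point `y` as origin, expanding `‖f_x - f_z‖ ^ 2` leaves only the cross term,
which has the right sign: the angle at `y` is not obtuse. -/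
lemma wiredResistance_triangle (x y z : V) :
    N.wiredResistance x z ≤ N.wiredResistance x y + N.wiredResistance y z := by
  have hyy : N.finKernel y y = 0 := by rw [← N.finKernel_sub y y y, sub_self]
  rw [N.wiredResistance_eq_norm_sub_sq y x z, N.wiredResistance_eq x y,
    N.wiredResistance_eq_norm_sub_sq y y z, hyy, zero_sub, norm_neg, norm_sub_sq_real]
  linarith [N.inner_finKernel_nonneg x y z]

lemma wiredResistance_self (x : V) : N.wiredResistance x x = 0 := by
  simp [N.wiredResistance_eq_norm_sub_sq x]

lemma wiredResistance_comm (x y : V) : N.wiredResistance x y = N.wiredResistance y x := by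
  rw [N.wiredResistance_eq_norm_sub_sq x, N.wiredResistance_eq_norm_sub_sq x y x, norm_sub_rev]

lemma eq_of_wiredResistance_eq_zero {x y : V} (h : N.wiredResistance x y = 0) : x = y := by
  rw [N.wiredResistance_eq_norm_sub_sq x, sq_eq_zero_iff, norm_eq_zero, sub_eq_zero] at h
  exact N.finKernel_injective x h

lemma sqrt_wiredResistance (o x y : V) :
    √(N.wiredResistance x y) = ‖N.finKernel o x - N.finKernel o y‖ := by
  rw [N.wiredResistance_eq_norm_sub_sq o, Real.sqrt_sq (norm_nonneg _)]

end ResistanceNetwork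

theorem mainTheorem10 {V : Type u} (N : ResistanceNetwork V) :
    -- the wired resistance is well defined: exhaustions exist, and the limit exists along each of
    -- them and does not depend on it
    (∃ G : ℕ → Finset V, N.IsExhaustion G) ∧
    (∀ G : ℕ → Finset V, N.IsExhaustion G → ∀ x y : V,
      Tendsto (fun k => N.wiredSubnetworkResistance (G k) x y) atTop
        (𝓝 (N.wiredResistance x y))) ∧
    -- it is a metric
    (∃ m : MetricSpace V, ∀ x y : V, m.dist x y = N.wiredResistance x y) ∧
    -- its square root is the distance in a Hilbert space, ...
    (∃ (H : Type u) (_ : NormedAddCommGroup H) (_ : InnerProductSpace ℝ H) (_ : CompleteSpace H)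
      (w : V → H), Function.Injective w ∧
        ∀ x y : V, √(N.wiredResistance x y) = ‖w x - w y‖) ∧
    -- ... for which one can take the subspace `FinSpace`, with the embedding `x ↦ f_x` for any origin `o`
    (∀ o : V, Function.Injective (N.finKernel o) ∧
      ∀ x y : V, √(N.wiredResistance x y) = ‖N.finKernel o x - N.finKernel o y‖) := by
  obtain ⟨o⟩ := N.connected.nonempty
  refine ⟨N.exists_isExhaustion, fun G hG x y => ?_, ?_, ?_, fun o => ?_⟩
  · rw [N.wiredResistance_eq]
    exact N.tendsto_wiredSubnetworkResistance hG x y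
  · exact ⟨{ dist := N.wiredResistance
             dist_self := N.wiredResistance_self
             dist_comm := N.wiredResistance_comm
             dist_triangle := N.wiredResistance_triangle
             eq_of_dist_eq_zero := N.eq_of_wiredResistance_eq_zero }, fun _ _ => rfl⟩
  · exact ⟨N.FinSpace, inferInstance, inferInstance, inferInstance, N.finKernel o,
      N.finKernel_injective o, N.sqrt_wiredResistance o⟩
  · exact ⟨N.finKernel_injective o, N.sqrt_wiredResistance o⟩
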